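/- **Theorem.** Let $Z, X, \Omega, \Theta$ be locally compact Hausdorff spaces and let $(\mathcal V,\mathcal V^\diamond)$ be a pair of real Banach spaces with a continuous bilinear pairing $\langle\cdot,\cdot\rangle_{\mathcal V}\colon \mathcal V^\diamond\times\mathcal V\to\mathbb R$ that is nondegenerate in both arguments. For a locally compact Hausdorff space $S$ and a Banach space $E$, let $\mathcal M(S;E)$ be the Banach space of countably additive $E$-valued Borel vector measures $\mu$ on $S$ whose total variation measure $|\mu|_E$ is finite and regular, with norm $|\mu|_E(S)$. Let $\phi\in C_0(Z\times\Omega)$ and $\psi\in C_0(X\times\Theta)$ be real-valued. For $\nu\in\mathcal M(\Theta;\mathcal V)$ put $A_{\Theta\to X}\nu=\int_\Theta\psi(\cdot,\theta)\,d\nu(\theta)\colon X\to\mathcal V$, and let $$\mathcal B=\{A_{\Theta\to X}\nu : \nu\in\mathcal M(\Theta;\mathcal V)\},\qquad \|f\|_{\mathcal B}=\inf\{|\nu|_{\mathcal V}(\Theta) : \nu \in \mathcal M(\Theta;\mathcal V),\ f=A_{\Theta\to X}\nu\},$$ which is a Banach space of functions $X\to\mathcal V$. For $E=\mathcal M(\Theta;\mathcal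 V)$ or $E=\mathcal B$ and $\mu\in\mathcal M(\Omega;E)$ put $(A_{\Omega\to Z}\mu)(z)=\int_\Omega\phi(z,w)\,d\mu(w)\in E$. Let $d,N\ge 1$ be integers, $(v_j^\diamond,x_j)\in\mathcal V^\diamond\times X$ for $1\le j\le d$, and let $M\colon\mathcal B\to\mathbb R^d$, $(Mf)_j=\langle v_j^\diamond,f(x_j)\rangle_{\mathcal V}$. Let $(z_n,y_n)\in Z\times\mathbb R^d$ for $1\le n\le N$, let $\lambda\ge 0$, and let $L\colon\mathbb R^d\times\mathbb R^d\to\mathbb R$ be such that $L(\cdot,y)$ is continuous for every $y\in\mathbb R^d$ (for example, convex for every $y$). Consider the weight-space problem $$\min_{\mu\in\mathcal M(\Omega;\mathcal M(\Theta;\mathcal V))}\ \frac1N\sum_{n=1}^N L\big(M(A_{\Theta\to X}((A_{\Omega\to Z}\mu)(z_n))),y_n\big)+\lambda\,|\mu|_{\mathcal M(\Theta;\mathcal V)}(\Omega)$$ and the function-space problem $$\min_{\mu\in\mathcal M(\Omega;\mathcal B)}\ \frac1N\sum_{n=1}^N L\big(M((A_{\Omega\to Z}\mu)(z_n)),y_n\big)+\lambda\,|\mu|_{\mathcal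 B}(\Omega).$$ If $\mu_{\mathcal M}^\dagger\in\mathcal M(\Omega;\mathcal M(\Theta;\mathcal V))$ is a minimizer of the weight-space problem, then $\mu_{\mathcal B}^\dagger(E):=A_{\Theta\to X}(\mu_{\mathcal M}^\dagger(E))$, for Borel $E\subseteq\Omega$, defines an element $\mu_{\mathcal B}^\dagger\in\mathcal M(\Omega;\mathcal B)$, and $\mu_{\mathcal B}^\dagger$ is a minimizer of the function-space problem. -/

import Mathlib

open MeasureTheory Filter Topology
open scoped ENNReal NNReal ZeroAtInfty

noncomputable section

namespace HyperNet

/-! ### Regular vector measures of finite total variation -/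

/-- A finite Borel measure that is inner regular for compact sets on Borel sets is regular. -/
theorem regular_of_forall_exists_isCompact {S : Type*} [TopologicalSpace S] [MeasurableSpace S]
    [BorelSpace S] [T2Space S] (ν : Measure S) [IsFiniteMeasure ν]
    (h : ∀ A, MeasurableSet A → ∀ ε : ℝ≥0∞, ε ≠ 0 → ∃ K ⊆ A, IsCompact K ∧ ν (A \ K) ≤ ε) :
    ν.Regular := by
  have key : ∀ a r : ℝ≥0∞, a < r → ∃ ε : ℝ≥0∞, ε ≠ 0 ∧ a + ε < r := by
    intro a r har
    obtain ⟨δ, hδ, hδr⟩ := ENNReal.lt_iff_exists_add_pos_lt.1 har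
    exact ⟨δ, by simpa using hδ.ne', hδr⟩
  have outer : ν.OuterRegular := by
    refine ⟨fun A hA r hr => ?_⟩
    obtain ⟨ε, hε, hεr⟩ := key _ _ hr
    obtain ⟨K, hKA, hK, hAK⟩ := h Aᶜ hA.compl ε hε
    refine ⟨Kᶜ, Set.subset_compl_comm.1 hKA, hK.isClosed.isOpen_compl, lt_of_le_of_lt ?_ hεr⟩
    have hsub : Kᶜ ⊆ A ∪ (Aᶜ \ K) := fun x hx => by
      by_cases hxA : x ∈ A
      · exact Or.inl hxA
      · exact Or.inr ⟨hxA, hx⟩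
    calc ν Kᶜ ≤ ν (A ∪ (Aᶜ \ K)) := measure_mono hsub
      _ ≤ ν A + ν (Aᶜ \ K) := measure_union_le _ _
      _ ≤ ν A + ε := by gcongr
  have inner : Measure.InnerRegularWRT ν IsCompact IsOpen := by
    intro U hU r hr
    obtain ⟨ε, hε, hεr⟩ := key _ _ hr
    obtain ⟨K, hKU, hK, hUK⟩ := h U hU.measurableSet ε hε
    refine ⟨K, hKU, hK, ?_⟩
    by_contra hcon
    rw [not_lt] at hcon
    refine absurd hεr (not_lt.2 ?_)
    calc ν U = ν (K ∪ (U \ K)) := by rw [Set.union_sdiff_cancel hKU]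
      _ ≤ ν K + ν (U \ K) := measure_union_le _ _
      _ ≤ r + ε := by gcongr
  exact { outer with innerRegular := inner, lt_top_of_isCompact := fun _ _ => measure_lt_top _ _ }

/-- A finite Borel measure that is dominated, up to arbitrarily small errors, by sums of two
regular finite measures is regular. -/
theorem regular_of_approx {S : Type*} [TopologicalSpace S] [MeasurableSpace S] [BorelSpace S]
    [T2Space S] (ν : Measure S) [IsFiniteMeasure ν]
    (h : ∀ ε : ℝ≥0∞, ε ≠ 0 → ∃ m₁ m₂ : Measure S, IsFiniteMeasure m₁ ∧ IsFiniteMeasure m₂ ∧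
      m₁.Regular ∧ m₂.Regular ∧ ∀ A, MeasurableSet A → ν A ≤ m₁ A + m₂ A + ε) : ν.Regular := by
  refine regular_of_forall_exists_isCompact ν fun A (hA : MeasurableSet A) ε hε => ?_
  have hε3 : ε / 3 ≠ 0 := by simp [hε]
  obtain ⟨m₁, m₂, _, _, _, _, hm⟩ := h (ε / 3) hε3
  obtain ⟨K₁, hKA₁, hK₁, hAK₁⟩ := hA.exists_isCompact_sdiff_lt (measure_ne_top m₁ A) hε3
  obtain ⟨K₂, hKA₂, hK₂, hAK₂⟩ := hA.exists_isCompact_sdiff_lt (measure_ne_top m₂ A) hε3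
  refine ⟨K₁ ∪ K₂, Set.union_subset hKA₁ hKA₂, hK₁.union hK₂, ?_⟩
  calc ν (A \ (K₁ ∪ K₂))
      ≤ m₁ (A \ (K₁ ∪ K₂)) + m₂ (A \ (K₁ ∪ K₂)) + ε / 3 :=
        hm _ (MeasurableSet.diff hA (IsCompact.measurableSet (hK₁.union hK₂)))
    _ ≤ m₁ (A \ K₁) + m₂ (A \ K₂) + ε / 3 := by
        gcongr
        · exact Set.subset_union_left
        · exact Set.subset_union_right
    _ ≤ ε / 3 + ε / 3 + ε / 3 := by gcongr
    _ = ε := ENNReal.add_thirds ε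

/-- `𝓜(S; E)` as a subspace of all vector measures: the regular countably additive `E`-valued
Borel measures on `S` with finite total variation. As usual, `μ` is called regular when its total
variation measure `|μ|` is regular. -/
def radonSubmodule (S : Type*) [TopologicalSpace S] [MeasurableSpace S] [BorelSpace S] [T2Space S]
    (E : Type*) [NormedAddCommGroup E] [NormedSpace ℝ E] : Submodule ℝ (VectorMeasure S E) where
  carrier := {μ | IsFiniteMeasure μ.variation ∧ μ.variation.Regular}
  zero_mem' := by
    simp only [Set.mem_ofPred_eq, VectorMeasure.variation_zero]
    exact ⟨inferInstance, inferInstance⟩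
  add_mem' := by
    rintro μ ν ⟨_, _⟩ ⟨_, _⟩
    have hfin : IsFiniteMeasure (μ + ν).variation :=
      isFiniteMeasure_of_le _ VectorMeasure.variation_add_le
    exact ⟨hfin, regular_of_approx _ fun ε _ => ⟨μ.variation, ν.variation, ‹_›, ‹_›, ‹_›, ‹_›,
      fun A _ => (VectorMeasure.variation_add_le A).trans le_self_add⟩⟩
  smul_mem' := by
    rintro c μ ⟨_, _⟩
    simp only [Set.mem_ofPred_eq, VectorMeasure.variation_smul]
    exact ⟨inferInstance, inferInstance⟩

/-- The space `𝓜(S; E)` of regular countably additive `E`-valued Borel vector measures on `S` with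
finite total variation. -/
def RadonMeasure (S : Type*) [TopologicalSpace S] [MeasurableSpace S] [BorelSpace S] [T2Space S]
    (E : Type*) [NormedAddCommGroup E] [NormedSpace ℝ E] : Type _ := radonSubmodule S E

namespace RadonMeasure

variable {S : Type*} [TopologicalSpace S] [MeasurableSpace S] [BorelSpace S] [T2Space S]
  {E : Type*} [NormedAddCommGroup E] [NormedSpace ℝ E]

instance : AddCommGroup (RadonMeasure S E) := inferInstanceAs (AddCommGroup (radonSubmodule S E))

instance : Module ℝ (RadonMeasure S E) := inferInstanceAs (Module ℝ (radonSubmodule S E))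

/-- The underlying vector measure, as a linear map. -/
def toVectorMeasure : RadonMeasure S E →ₗ[ℝ] VectorMeasure S E := (radonSubmodule S E).subtype

/-- Bundling a regular vector measure of finite total variation. -/
def mk (v : VectorMeasure S E) (hfin : IsFiniteMeasure v.variation) (hreg : v.variation.Regular) :
    RadonMeasure S E := ⟨v, hfin, hreg⟩

@[simp]
theorem toVectorMeasure_mk (v : VectorMeasure S E) (hfin : IsFiniteMeasure v.variation)
    (hreg : v.variation.Regular) : toVectorMeasure (mk v hfin hreg) = v := rfl

/-- A vector-valued Radon measure is a set function. -/
instance : CoeFun (RadonMeasure S E) (fun _ => Set S → E) := ⟨fun μ => ⇑(toVectorMeasure μ)⟩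

instance (μ : RadonMeasure S E) : IsFiniteMeasure (toVectorMeasure μ).variation := μ.2.1

instance (μ : RadonMeasure S E) : (toVectorMeasure μ).variation.Regular := μ.2.2

theorem toVectorMeasure_injective :
    Function.Injective (toVectorMeasure : RadonMeasure S E →ₗ[ℝ] VectorMeasure S E) :=
  Subtype.val_injective

/-- The norm of `𝓜(S; E)` is the total variation `|μ|(S)`. -/
instance : Norm (RadonMeasure S E) := ⟨fun μ => ((toVectorMeasure μ).variation Set.univ).toReal⟩

theorem norm_def (μ : RadonMeasure S E) :
    ‖μ‖ = ((toVectorMeasure μ).variation Set.univ).toReal := rfl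

theorem ofReal_norm (μ : RadonMeasure S E) :
    ENNReal.ofReal ‖μ‖ = (toVectorMeasure μ).variation Set.univ :=
  ENNReal.ofReal_toReal (measure_ne_top _ _)

theorem normCore : NormedSpace.Core ℝ (RadonMeasure S E) where
  norm_nonneg _ := ENNReal.toReal_nonneg
  norm_smul c μ := by
    simp [norm_def, VectorMeasure.variation_smul]
  norm_triangle μ ν := by
    rw [norm_def, norm_def, norm_def, ← ENNReal.toReal_add (measure_ne_top _ _)
      (measure_ne_top _ _), map_add]
    exact ENNReal.toReal_mono (by simp) (VectorMeasure.variation_add_le Set.univ)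
  norm_eq_zero_iff μ := by
    rw [norm_def, ENNReal.toReal_eq_zero_iff]
    simp [← (toVectorMeasure_injective (S := S) (E := E)).eq_iff]

instance : NormedAddCommGroup (RadonMeasure S E) := NormedAddCommGroup.ofCore normCore

instance : NormedSpace ℝ (RadonMeasure S E) := NormedSpace.ofCore normCore

theorem norm_apply_le (μ : RadonMeasure S E) (A : Set S) : ‖μ A‖ ≤ ‖μ‖ :=
  (VectorMeasure.norm_measure_le_variation (measure_ne_top _ _)).trans
    (ENNReal.toReal_mono (measure_ne_top _ _) (measure_mono (Set.subset_univ A)))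

theorem enorm_apply_le (μ : RadonMeasure S E) (A : Set S) :
    ‖μ A‖ₑ ≤ (toVectorMeasure μ).variation A := VectorMeasure.enorm_measure_le_variation _ _

/-- `𝓜(S; E)` is a Banach space. -/
instance [CompleteSpace E] : CompleteSpace (RadonMeasure S E) := by
  refine NormedAddCommGroup.completeSpace_of_summable_imp_tendsto fun u hu => ?_
  have hsum : ∀ A : Set S, Summable fun n => u n A := fun A =>
    Summable.of_norm_bounded hu fun n => norm_apply_le (u n) A
  have htail : ∀ N, ∑' n, (toVectorMeasure (u (n + N))).variation Set.univ
      = ENNReal.ofReal (∑' n, ‖u (n + N)‖) := fun N => by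
    rw [ENNReal.ofReal_tsum_of_nonneg (fun _ => norm_nonneg _) ((summable_nat_add_iff N).2 hu)]
    exact tsum_congr fun n => (ofReal_norm _).symm
  let v : VectorMeasure S E :=
    { measureOf' := fun A => ∑' n, u n A
      empty' := by simp
      not_measurable' := fun A hA => by simp [hA]
      m_iUnion' := fun f hf hd => by
        have h1 : ∀ n, HasSum (fun i => u n (f i)) (u n (⋃ i, f i)) := fun n =>
          (toVectorMeasure (u n)).m_iUnion hf hd
        have h2 : Summable fun p : ℕ × ℕ => u p.1 (f p.2) := by
          refine Summable.of_enorm ?_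
          rw [ENNReal.tsum_prod']
          refine ne_top_of_le_ne_top (b := ∑' n, (toVectorMeasure (u n)).variation Set.univ) ?_ ?_
          · have := htail 0
            simp only [add_zero] at this
            rw [this]
            exact ENNReal.ofReal_ne_top
          · refine ENNReal.tsum_le_tsum fun n => ?_
            calc ∑' i, ‖u n (f i)‖ₑ ≤ ∑' i, (toVectorMeasure (u n)).variation (f i) :=
                  ENNReal.tsum_le_tsum fun i => enorm_apply_le _ _
              _ = (toVectorMeasure (u n)).variation (⋃ i, f i) := (measure_iUnion hd hf).symm
              _ ≤ _ := measure_mono (Set.subset_univ _)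
        have h3 := h2.hasSum
        have h4 : ∑' p : ℕ × ℕ, u p.1 (f p.2) = ∑' n, u n (⋃ i, f i) :=
          (h3.prod_fiberwise h1).tsum_eq.symm
        rw [h4] at h3
        have h5 := (Equiv.prodComm ℕ ℕ).hasSum_iff.2 h3
        exact h5.prod_fiberwise fun i => (hsum (f i)).hasSum }
  have hv : ∀ N, (v - toVectorMeasure (∑ n ∈ Finset.range N, u n)).variation
      ≤ Measure.sum fun n => (toVectorMeasure (u (n + N))).variation := fun N => by
    refine VectorMeasure.variation_le_of_forall_enorm_le fun A hA => ?_
    have h1 : (v - toVectorMeasure (∑ n ∈ Finset.range N, u n)) A = ∑' n, u (n + N) A := by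
      have h2 : v A = ∑' n, u n A := rfl
      have h3 : toVectorMeasure (∑ n ∈ Finset.range N, u n) A = ∑ n ∈ Finset.range N, u n A := by
        simp
      have h4 := (hsum A).sum_add_tsum_nat_add N
      rw [sub_apply, h2, h3, ← h4, add_sub_cancel_left]
    rw [h1, Measure.sum_apply _ hA]
    exact enorm_tsum_le_tsum_enorm.trans (ENNReal.tsum_le_tsum fun n => enorm_apply_le _ _)
  have hvN : ∀ N A, (v - toVectorMeasure (∑ n ∈ Finset.range N, u n)).variation A
      ≤ ENNReal.ofReal (∑' n, ‖u (n + N)‖) := fun N A => by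
    rw [← htail N, ← Measure.sum_apply _ MeasurableSet.univ]
    exact (measure_mono (Set.subset_univ _)).trans (hv N _)
  have hle : ∀ N A, v.variation A ≤ (toVectorMeasure (∑ n ∈ Finset.range N, u n)).variation A
      + ENNReal.ofReal (∑' n, ‖u (n + N)‖) := fun N A => by
    calc v.variation A = (toVectorMeasure (∑ n ∈ Finset.range N, u n)
          + (v - toVectorMeasure (∑ n ∈ Finset.range N, u n))).variation A := by
          rw [add_sub_cancel]
      _ ≤ _ := VectorMeasure.variation_add_le A
      _ ≤ _ := by
        rw [Measure.add_apply]
        gcongr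
        exact hvN N A
  have hlim : Tendsto (fun N => ∑' n, ‖u (n + N)‖) atTop (𝓝 0) :=
    tendsto_sum_nat_add fun n => ‖u n‖
  have hfin : IsFiniteMeasure v.variation :=
    ⟨(hle 0 Set.univ).trans_lt (ENNReal.add_lt_top.2 ⟨measure_lt_top _ _, ENNReal.ofReal_lt_top⟩)⟩
  have hreg : v.variation.Regular := by
    refine regular_of_approx _ fun ε hε => ?_
    have h0 : Tendsto (fun N => ENNReal.ofReal (∑' n, ‖u (n + N)‖)) atTop (𝓝 0) := by
      simpa using ENNReal.tendsto_ofReal hlim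
    obtain ⟨N, hN⟩ := (h0.eventually (gt_mem_nhds (pos_iff_ne_zero.2 hε))).exists
    refine ⟨(toVectorMeasure (∑ n ∈ Finset.range N, u n)).variation, 0, inferInstance,
      inferInstance, (∑ n ∈ Finset.range N, u n).2.2, inferInstance, fun A _ => ?_⟩
    refine (hle N A).trans ?_
    rw [Measure.coe_zero, Pi.zero_apply, add_zero]
    gcongr
  refine ⟨mk v hfin hreg, ?_⟩
  rw [tendsto_iff_norm_sub_tendsto_zero]
  refine squeeze_zero (fun _ => norm_nonneg _) (fun N => ?_) hlim
  rw [norm_sub_rev]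
  refine ENNReal.toReal_le_of_le_ofReal (tsum_nonneg fun _ => norm_nonneg _) ?_
  rw [map_sub, toVectorMeasure_mk]
  exact hvN N Set.univ

end RadonMeasure

/-! ### The integral operators -/

section IntegralOperator

variable {Y S : Type*} [TopologicalSpace Y] [TopologicalSpace S] [MeasurableSpace S] [BorelSpace S]

theorem integrable_kernel (φ : C₀(Y × S, ℝ)) (y : Y) (m : Measure S) [IsFiniteMeasure m] :
    Integrable (fun s => φ (y, s)) m := by
  have hc : Continuous fun s => φ (y, s) := by fun_prop
  refine Integrable.of_bound hc.measurable.aestronglyMeasurable ‖φ.toBCF‖ ?_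
  exact Eventually.of_forall fun s => φ.toBCF.norm_coe_le_norm (y, s)

variable [T2Space S] {E : Type*} [NormedAddCommGroup E] [NormedSpace ℝ E]

/-- The integral operator `(A μ)(y) = ∫ φ(y, s) dμ(s)` with kernel `φ ∈ C₀(Y × S)`, acting on
`E`-valued measures `μ ∈ 𝓜(S; E)` and producing functions `Y → E`. -/
def integralOp (φ : C₀(Y × S, ℝ)) : RadonMeasure S E →ₗ[ℝ] (Y → E) where
  toFun μ y := ∫ᵛ s, φ (y, s) ∂•(RadonMeasure.toVectorMeasure μ)
  map_add' μ ν := by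
    funext y
    rw [map_add]
    exact VectorMeasure.integral_add_vectorMeasure (integrable_kernel φ y _)
      (integrable_kernel φ y _)
  map_smul' c μ := by
    funext y
    rw [map_smul]
    exact VectorMeasure.integral_smul_vectorMeasure _ c

theorem norm_integralOp_le (φ : C₀(Y × S, ℝ)) (μ : RadonMeasure S E) (y : Y) :
    ‖integralOp φ μ y‖ ≤ ‖φ.toBCF‖ * ‖μ‖ := by
  have h := VectorMeasure.norm_integral_le_of_norm_le_const
    (μ := RadonMeasure.toVectorMeasure μ) (f := fun s => φ (y, s))
    (B := ContinuousLinearMap.lsmul ℝ ℝ) (C := ‖φ.toBCF‖)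
    (Eventually.of_forall fun s => φ.toBCF.norm_coe_le_norm (y, s))
  refine h.trans ?_
  have h1 : ‖(ContinuousLinearMap.lsmul ℝ ℝ : ℝ →L[ℝ] E →L[ℝ] E)‖ ≤ 1 :=
    ContinuousLinearMap.opNorm_lsmul_le
  calc _ ≤ ‖φ.toBCF‖ * 1 * (RadonMeasure.toVectorMeasure μ).variation.real Set.univ := by gcongr
    _ = _ := by rw [mul_one]; rfl

end IntegralOperator

/-! ### The integral vector-valued reproducing kernel Banach space -/

/-- The integral vector-valued RKBS `𝓑 = {A ν | ν ∈ 𝓜(Θ; V)}` of functions `X → V` with kernel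
`ψ ∈ C₀(X × Θ)`. -/
def IntegralRKBS {X Θ : Type*} [TopologicalSpace X] [TopologicalSpace Θ] [MeasurableSpace Θ]
    [BorelSpace Θ] [T2Space Θ] (ψ : C₀(X × Θ, ℝ)) (V : Type*) [NormedAddCommGroup V]
    [NormedSpace ℝ V] : Type _ :=
  LinearMap.range (integralOp ψ : RadonMeasure Θ V →ₗ[ℝ] (X → V))

namespace IntegralRKBS

variable {X Θ : Type*} [TopologicalSpace X] [TopologicalSpace Θ] [MeasurableSpace Θ]
  [BorelSpace Θ] [T2Space Θ] {ψ : C₀(X × Θ, ℝ)} {V : Type*} [NormedAddCommGroup V]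
  [NormedSpace ℝ V]

instance : AddCommGroup (IntegralRKBS ψ V) :=
  inferInstanceAs (AddCommGroup (LinearMap.range (integralOp ψ : RadonMeasure Θ V →ₗ[ℝ] (X → V))))

instance : Module ℝ (IntegralRKBS ψ V) :=
  inferInstanceAs (Module ℝ (LinearMap.range (integralOp ψ : RadonMeasure Θ V →ₗ[ℝ] (X → V))))

/-- The function `X → V` underlying an element of the space, as a linear map. -/
def toFunction : IntegralRKBS ψ V →ₗ[ℝ] (X → V) :=
  (LinearMap.range (integralOp ψ : RadonMeasure Θ V →ₗ[ℝ] (X → V))).subtype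

instance : CoeFun (IntegralRKBS ψ V) (fun _ => X → V) := ⟨fun f => toFunction f⟩

theorem toFunction_injective :
    Function.Injective (toFunction : IntegralRKBS ψ V →ₗ[ℝ] (X → V)) := Subtype.val_injective

/-- The operator `A_{Θ → X} : 𝓜(Θ; V) → 𝓑`, `A ν = ∫ ψ(·, θ) dν(θ)`. -/
def ofMeasure (ψ : C₀(X × Θ, ℝ)) : RadonMeasure Θ V →ₗ[ℝ] IntegralRKBS ψ V :=
  (integralOp ψ : RadonMeasure Θ V →ₗ[ℝ] (X → V)).rangeRestrict

theorem toFunction_ofMeasure (ν : RadonMeasure Θ V) :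
    toFunction (ofMeasure ψ ν) = integralOp ψ ν := rfl

theorem ofMeasure_surjective :
    Function.Surjective (ofMeasure ψ : RadonMeasure Θ V →ₗ[ℝ] IntegralRKBS ψ V) :=
  (integralOp ψ : RadonMeasure Θ V →ₗ[ℝ] (X → V)).surjective_rangeRestrict

/-- The norm `‖f‖ = inf {|ν|(Θ) | ν ∈ 𝓜(Θ; V), f = A ν}`. -/
instance : Norm (IntegralRKBS ψ V) :=
  ⟨fun f => sInf {r : ℝ | ∃ ν : RadonMeasure Θ V, ofMeasure ψ ν = f ∧ ‖ν‖ = r}⟩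

theorem norm_def (f : IntegralRKBS ψ V) :
    ‖f‖ = sInf {r : ℝ | ∃ ν : RadonMeasure Θ V, ofMeasure ψ ν = f ∧ ‖ν‖ = r} := rfl

theorem norm_ofMeasure_le (ν : RadonMeasure Θ V) : ‖ofMeasure ψ ν‖ ≤ ‖ν‖ := by
  refine csInf_le ⟨0, ?_⟩ ⟨ν, rfl, rfl⟩
  rintro _ ⟨ν', -, rfl⟩
  exact norm_nonneg ν'

theorem exists_norm_lt (f : IntegralRKBS ψ V) {ε : ℝ} (hε : 0 < ε) :
    ∃ ν : RadonMeasure Θ V, ofMeasure ψ ν = f ∧ ‖ν‖ < ‖f‖ + ε := by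
  obtain ⟨ν₀, hν₀⟩ := ofMeasure_surjective f
  obtain ⟨_, ⟨ν, hν, rfl⟩, hlt⟩ := exists_lt_of_csInf_lt
    (s := {r : ℝ | ∃ ν : RadonMeasure Θ V, ofMeasure ψ ν = f ∧ ‖ν‖ = r})
    ⟨_, ν₀, hν₀, rfl⟩ (lt_add_of_pos_right _ hε)
  exact ⟨ν, hν, hlt⟩

theorem norm_toFunction_le (f : IntegralRKBS ψ V) (x : X) :
    ‖toFunction f x‖ ≤ ‖ψ.toBCF‖ * ‖f‖ := by
  refine le_of_forall_pos_le_add fun ε hε => ?_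
  have hC : 0 < ‖ψ.toBCF‖ + 1 := by positivity
  obtain ⟨ν, rfl, hν⟩ := exists_norm_lt f (div_pos hε hC)
  rw [toFunction_ofMeasure]
  calc ‖integralOp ψ ν x‖ ≤ ‖ψ.toBCF‖ * ‖ν‖ := norm_integralOp_le ψ ν x
    _ ≤ ‖ψ.toBCF‖ * (‖ofMeasure ψ ν‖ + ε / (‖ψ.toBCF‖ + 1)) := by gcongr
    _ = ‖ψ.toBCF‖ * ‖ofMeasure ψ ν‖ + ‖ψ.toBCF‖ / (‖ψ.toBCF‖ + 1) * ε := by ring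
    _ ≤ ‖ψ.toBCF‖ * ‖ofMeasure ψ ν‖ + 1 * ε := by
      gcongr
      rw [div_le_one hC]
      linarith
    _ = _ := by rw [one_mul]

theorem normCore : NormedSpace.Core ℝ (IntegralRKBS ψ V) where
  norm_nonneg f := by
    refine Real.sInf_nonneg ?_
    rintro _ ⟨ν, -, rfl⟩
    exact norm_nonneg ν
  norm_smul c f := by
    have hle : ∀ (c : ℝ) (f : IntegralRKBS ψ V), ‖c • f‖ ≤ ‖c‖ * ‖f‖ := fun c f => by
      refine le_of_forall_pos_le_add fun ε hε => ?_
      have hC : 0 < ‖c‖ + 1 := by positivity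
      obtain ⟨ν, rfl, hν⟩ := exists_norm_lt f (div_pos hε hC)
      rw [← map_smul]
      calc ‖ofMeasure ψ (c • ν)‖ ≤ ‖c • ν‖ := norm_ofMeasure_le _
        _ = ‖c‖ * ‖ν‖ := norm_smul c ν
        _ ≤ ‖c‖ * (‖ofMeasure ψ ν‖ + ε / (‖c‖ + 1)) := by gcongr
        _ = ‖c‖ * ‖ofMeasure ψ ν‖ + ‖c‖ / (‖c‖ + 1) * ε := by ring
        _ ≤ ‖c‖ * ‖ofMeasure ψ ν‖ + 1 * ε := by
          gcongr
          rw [div_le_one hC]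
          linarith
        _ = _ := by rw [one_mul]
    refine le_antisymm (hle c f) ?_
    rcases eq_or_ne c 0 with rfl | hc
    · have h0 : (0 : ℝ) ≤ ‖(0 : ℝ) • f‖ := by
        refine Real.sInf_nonneg ?_
        rintro _ ⟨ν, -, rfl⟩
        exact norm_nonneg ν
      simpa using h0
    · have h := hle c⁻¹ (c • f)
      rw [inv_smul_smul₀ hc, norm_inv] at h
      have hc' : 0 < ‖c‖ := norm_pos_iff.2 hc
      calc ‖c‖ * ‖f‖ ≤ ‖c‖ * (‖c‖⁻¹ * ‖c • f‖) := by gcongr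
        _ = ‖c • f‖ := by rw [mul_inv_cancel_left₀ hc'.ne']
  norm_triangle f g := by
    refine le_of_forall_pos_le_add fun ε hε => ?_
    obtain ⟨ν, rfl, hν⟩ := exists_norm_lt f (half_pos hε)
    obtain ⟨ν', rfl, hν'⟩ := exists_norm_lt g (half_pos hε)
    rw [← map_add]
    have h1 := norm_ofMeasure_le (ψ := ψ) (ν + ν')
    have h2 := norm_add_le ν ν'
    linarith
  norm_eq_zero_iff f := by
    constructor
    · intro h
      refine toFunction_injective (funext fun x => ?_)
      have h1 := norm_toFunction_le f x
      rw [h, mul_zero] at h1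
      simpa using norm_le_zero_iff.1 h1
    · rintro rfl
      refine le_antisymm ?_ ?_
      · simpa using norm_ofMeasure_le (ψ := ψ) (0 : RadonMeasure Θ V)
      · refine Real.sInf_nonneg ?_
        rintro _ ⟨ν, -, rfl⟩
        exact norm_nonneg ν

instance : NormedAddCommGroup (IntegralRKBS ψ V) := NormedAddCommGroup.ofCore normCore

instance : NormedSpace ℝ (IntegralRKBS ψ V) := NormedSpace.ofCore normCore

/-- The integral RKBS is a Banach space. -/
instance [CompleteSpace V] : CompleteSpace (IntegralRKBS ψ V) := by
  refine NormedAddCommGroup.completeSpace_of_summable_imp_tendsto fun u hu => ?_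
  have hpos : ∀ n : ℕ, (0 : ℝ) < (1 / 2) ^ n := fun n => by positivity
  choose ν hν hlt using fun n => exists_norm_lt (u n) (hpos n)
  have hs : Summable ν := Summable.of_norm_bounded
    (hu.add summable_geometric_two) fun n => (hlt n).le
  refine ⟨ofMeasure ψ (∑' n, ν n), ?_⟩
  have h := hs.hasSum.tendsto_sum_nat
  rw [tendsto_iff_norm_sub_tendsto_zero] at h ⊢
  refine squeeze_zero (fun _ => norm_nonneg _) (fun N => ?_) h
  have : ∑ n ∈ Finset.range N, u n - ofMeasure ψ (∑' n, ν n)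
      = ofMeasure ψ (∑ n ∈ Finset.range N, ν n - ∑' n, ν n) := by
    rw [map_sub, map_sum]
    simp_rw [hν]
  rw [this]
  exact norm_ofMeasure_le _

end IntegralRKBS

/-! ### The optimization problems -/

/-- A continuous dual pair `(V, V')`: a continuous bilinear pairing `V' × V → ℝ` that is
nondegenerate in both arguments. -/
structure ContinuousDualPair (V V' : Type*) [NormedAddCommGroup V] [NormedSpace ℝ V]
    [NormedAddCommGroup V'] [NormedSpace ℝ V'] where
  /-- The pairing `⟨v', v⟩`. -/
  pairing : V' →L[ℝ] V →L[ℝ] ℝ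
  eq_zero_of_forall_left : ∀ v : V, (∀ v' : V', pairing v' v = 0) → v = 0
  eq_zero_of_forall_right : ∀ v' : V', (∀ v : V, pairing v' v = 0) → v' = 0

section Problems

variable {Z X Ω Θ : Type*} [TopologicalSpace Z] [TopologicalSpace X]
  [TopologicalSpace Ω] [MeasurableSpace Ω] [BorelSpace Ω] [T2Space Ω]
  [TopologicalSpace Θ] [MeasurableSpace Θ] [BorelSpace Θ] [T2Space Θ]
  {V V' : Type*} [NormedAddCommGroup V] [NormedSpace ℝ V]
  [NormedAddCommGroup V'] [NormedSpace ℝ V']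

/-- The measurement operator `M : 𝓑 → ℝᵈ`, `(M f)ⱼ = ⟨v'ⱼ, f(xⱼ)⟩`. -/
def measurement (P : ContinuousDualPair V V') (ψ : C₀(X × Θ, ℝ)) {d : ℕ}
    (v' : Fin d → V') (x : Fin d → X) (f : IntegralRKBS ψ V) : Fin d → ℝ :=
  fun j => P.pairing (v' j) (f (x j))

/-- The objective of the weight-space problem,
`(1/N) ∑ₙ L(M(A_{Θ → X}((A_{Ω → Z} μ)(zₙ))), yₙ) + lam |μ|(Ω)` for `μ ∈ 𝓜(Ω; 𝓜(Θ; V))`. -/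
def weightObjective (P : ContinuousDualPair V V') (φ : C₀(Z × Ω, ℝ)) (ψ : C₀(X × Θ, ℝ))
    {d N : ℕ} (v' : Fin d → V') (x : Fin d → X) (z : Fin N → Z) (y : Fin N → Fin d → ℝ)
    (L : (Fin d → ℝ) → (Fin d → ℝ) → ℝ) (lam : ℝ)
    (μ : RadonMeasure Ω (RadonMeasure Θ V)) : ℝ :=
  (1 / (N : ℝ)) * ∑ n, L (measurement P ψ v' x (IntegralRKBS.ofMeasure ψ (integralOp φ μ (z n))))
    (y n) + lam * ‖μ‖

/-- The objective of the function-space problem,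
`(1/N) ∑ₙ L(M((A_{Ω → Z} μ)(zₙ)), yₙ) + lam |μ|(Ω)` for `μ ∈ 𝓜(Ω; 𝓑)`. -/
def functionObjective (P : ContinuousDualPair V V') (φ : C₀(Z × Ω, ℝ)) (ψ : C₀(X × Θ, ℝ))
    {d N : ℕ} (v' : Fin d → V') (x : Fin d → X) (z : Fin N → Z) (y : Fin N → Fin d → ℝ)
    (L : (Fin d → ℝ) → (Fin d → ℝ) → ℝ) (lam : ℝ)
    (μ : RadonMeasure Ω (IntegralRKBS ψ V)) : ℝ :=
  (1 / (N : ℝ)) * ∑ n, L (measurement P ψ v' x (integralOp φ μ (z n))) (y n) + lam * ‖μ‖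

end Problems

end HyperNet
end

open MeasureTheory Filter Topology
open scoped ENNReal NNReal ZeroAtInfty

noncomputable section

namespace HyperNet

/-! The operator `A = A_{Θ → X}` is a contraction from `𝓜(Θ; V)` onto `𝓑`, since the norm of `𝓑` is
the quotient norm. Applying `A` to the values of a measure therefore does not increase total
variation, and it commutes with integration against `φ` (`integral_mapRange`). So the function-space
objective at the image of `μM` is at most the weight-space objective at `μM`.

It remains to see that the weight-space minimum bounds the function-space objective from below at
every `μ`. Choosing preimages of the values of `μ` set by set need not give an additive set
function, so `μ` is not lifted exactly. But the data terms see only the finitely many functions `φ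
(z n, ·)`. Partition `Ω` into finitely many cells on which all of these vary by at most `δ`,
concentrate the mass of each cell at one point, and lift these finitely many masses with small loss
of norm (`exists_lift_near`). As `δ → 0` the data terms converge by continuity of `L` and of point
evaluation on `𝓑`, while the norms exceed `‖μ‖` by at most `δ`. -/

/-! ### Regularity, and images of vector measures under contractions. -/

/-- A finite Borel measure dominated by a finite regular measure is regular. -/
theorem regular_of_le {S : Type*} [TopologicalSpace S] [MeasurableSpace S] [BorelSpace S]
    [T2Space S] {ν m : Measure S} [IsFiniteMeasure m] [m.Regular] (h : ν ≤ m) : ν.Regular := by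
  have : IsFiniteMeasure ν := isFiniteMeasure_of_le _ h
  refine regular_of_approx ν fun ε _ => ⟨m, 0, inferInstance, inferInstance, inferInstance,
    inferInstance, fun A _ => (h A).trans ?_⟩
  rw [add_assoc]
  exact le_self_add

theorem regular_dirac {S : Type*} [TopologicalSpace S] [MeasurableSpace S] [BorelSpace S]
    [T2Space S] (s : S) : (Measure.dirac s).Regular := by
  refine regular_of_forall_exists_isCompact _ fun A hA ε _ => ?_
  by_cases hs : s ∈ A
  · refine ⟨{s}, by simpa using hs, isCompact_singleton, ?_⟩
    rw [Measure.dirac_apply' _ (hA.diff (measurableSet_singleton s))]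
    simp
  · refine ⟨∅, Set.empty_subset _, isCompact_empty, ?_⟩
    rw [Set.sdiff_empty, Measure.dirac_apply' _ hA]
    simp [hs]

/-- The variation is the least measure dominating the norms of the values, so the bound need only be
checked one set at a time. -/
theorem variation_mapRange_le {S : Type*} [MeasurableSpace S] {E F : Type*}
    [NormedAddCommGroup E] [NormedSpace ℝ E] [NormedAddCommGroup F] [NormedSpace ℝ F]
    (μ : VectorMeasure S E) (T : E →L[ℝ] F) (hT : ∀ e, ‖T e‖ ≤ ‖e‖) :
    (μ.mapRange T.toAddMonoidHom T.continuous).variation ≤ μ.variation := by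
  refine VectorMeasure.variation_le_of_forall_enorm_le fun A _ => ?_
  refine le_trans ?_ (VectorMeasure.enorm_measure_le_variation μ A)
  exact enorm_le_iff_norm_le.2 (hT (μ A))

/-- Integration of scalar functions commutes with linear contractions. -/
theorem integral_mapRange {S : Type*} [MeasurableSpace S] {E F : Type*}
    [NormedAddCommGroup E] [NormedSpace ℝ E] [CompleteSpace E]
    [NormedAddCommGroup F] [NormedSpace ℝ F] [CompleteSpace F]
    (μ : VectorMeasure S E) (T : E →L[ℝ] F) (hT : ∀ e, ‖T e‖ ≤ ‖e‖) {f : S → ℝ}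
    (hf : μ.Integrable f) :
    ∫ᵛ s, f s ∂•(μ.mapRange T.toAddMonoidHom T.continuous) = T (∫ᵛ s, f s ∂•μ) := by
  -- By linearity `c • T (μ A) = T (c • μ A)`, so both integrals extend the same operator-valued set
  -- function.
  have h : (μ.mapRange T.toAddMonoidHom T.continuous).transpose (ContinuousLinearMap.lsmul ℝ ℝ)
      = μ.transpose ((ContinuousLinearMap.compL ℝ E E F T) ∘L ContinuousLinearMap.lsmul ℝ ℝ) := by
    refine VectorMeasure.ext fun A _ => ContinuousLinearMap.ext fun c => ?_
    exact (T.map_smul c (μ A)).symm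
  rw [VectorMeasure.continuousLinearMap_apply_integral hf, VectorMeasure.integral_eq_setToFun,
    VectorMeasure.integral_eq_setToFun]
  simp only [h]
  -- The two extensions differ only in the dominating measure: one uses the variation of the image,
  -- the other the larger variation of `μ`.
  refine (setToFun_congr_measure_of_integrable 1 ENNReal.one_ne_top ?_ _ _ f hf).symm
  rw [one_smul]
  exact variation_mapRange_le μ T hT

/-! ### Contractions and point masses in `𝓜(S; E)`. -/

namespace RadonMeasure

variable {S : Type*} [TopologicalSpace S] [MeasurableSpace S] [BorelSpace S] [T2Space S]
  {E F : Type*} [NormedAddCommGroup E] [NormedSpace ℝ E] [NormedAddCommGroup F] [NormedSpace ℝ F]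

/-- The image of a vector-valued Radon measure under a linear contraction of the value space. -/
def mapRange (T : E →L[ℝ] F) (hT : ∀ e, ‖T e‖ ≤ ‖e‖) (μ : RadonMeasure S E) : RadonMeasure S F :=
  mk ((toVectorMeasure μ).mapRange T.toAddMonoidHom T.continuous)
    (isFiniteMeasure_of_le _ (variation_mapRange_le _ T hT))
    (regular_of_le (variation_mapRange_le _ T hT))

theorem mapRange_apply (T : E →L[ℝ] F) (hT : ∀ e, ‖T e‖ ≤ ‖e‖) (μ : RadonMeasure S E)
    (A : Set S) : mapRange T hT μ A = T (μ A) := rfl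

theorem norm_mapRange_le (T : E →L[ℝ] F) (hT : ∀ e, ‖T e‖ ≤ ‖e‖) (μ : RadonMeasure S E) :
    ‖mapRange T hT μ‖ ≤ ‖μ‖ :=
  ENNReal.toReal_mono (measure_ne_top _ _) (variation_mapRange_le _ T hT Set.univ)

theorem integralOp_mapRange {Y : Type*} [TopologicalSpace Y] [CompleteSpace E] [CompleteSpace F]
    (φ : C₀(Y × S, ℝ)) (T : E →L[ℝ] F) (hT : ∀ e, ‖T e‖ ≤ ‖e‖) (μ : RadonMeasure S E) (y : Y) :
    integralOp φ (mapRange T hT μ) y = T (integralOp φ μ y) :=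
  integral_mapRange _ T hT (integrable_kernel φ y _)

/-- The point mass at `s` with value `e`. -/
def dirac (s : S) (e : E) : RadonMeasure S E :=
  mk (VectorMeasure.dirac s e) inferInstance <| by
    rw [VectorMeasure.variation_dirac]
    have := regular_dirac s
    exact Measure.Regular.smul enorm_ne_top

theorem norm_dirac (s : S) (e : E) : ‖dirac s e‖ = ‖e‖ := by
  simp [norm_def, dirac]

theorem integralOp_dirac {Y : Type*} [TopologicalSpace Y] [CompleteSpace E] (φ : C₀(Y × S, ℝ))
    (s : S) (e : E) (y : Y) : integralOp φ (dirac s e) y = φ (y, s) • e := by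
  change ∫ᵛ t, φ (y, t) ∂•(VectorMeasure.dirac s e) = _
  rw [VectorMeasure.integral_dirac]
  rfl

/-- The fibres of a simple function are finitely many disjoint measurable sets. This controls the
total mass of the discretized measure. -/
theorem sum_norm_preimage_le (μ : RadonMeasure S E) (g : SimpleFunc S S) :
    ∑ w ∈ g.range, ‖μ (g ⁻¹' {w})‖ ≤ ‖μ‖ := by
  have h : ∑ w ∈ g.range, (toVectorMeasure μ).variation (g ⁻¹' {w})
      ≤ (toVectorMeasure μ).variation Set.univ := by
    rw [sum_measure_preimage_singleton _ fun w _ => g.measurableSet_fiber w]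
    exact measure_mono (Set.subset_univ _)
  calc ∑ w ∈ g.range, ‖μ (g ⁻¹' {w})‖
      ≤ ∑ w ∈ g.range, ((toVectorMeasure μ).variation (g ⁻¹' {w})).toReal :=
        Finset.sum_le_sum fun w _ => VectorMeasure.norm_measure_le_variation (measure_ne_top _ _)
    _ = (∑ w ∈ g.range, (toVectorMeasure μ).variation (g ⁻¹' {w})).toReal :=
        (ENNReal.toReal_sum fun w _ => measure_ne_top _ _).symm
    _ ≤ ‖μ‖ := ENNReal.toReal_mono (measure_ne_top _ _) h

end RadonMeasure

open RadonMeasure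

/-! ### Discretizing the integral transform at finitely many points. -/

section Discretization

variable {Y S : Type*} [TopologicalSpace Y] [TopologicalSpace S] [MeasurableSpace S] [BorelSpace S]

/-- Finitely many sections of a `C₀` kernel are uniformly approximated by precomposing them with a
simple map of the domain into itself. -/
theorem exists_simpleFunc_kernel_near (φ : C₀(Y × S, ℝ)) {N : ℕ} (y : Fin N → Y) {δ : ℝ}
    (hδ : 0 < δ) : ∃ g : SimpleFunc S S, ∀ n s, |φ (y n, s) - φ (y n, g s)| ≤ δ := by
  rcases isEmpty_or_nonempty S with hS | hS
  · exact ⟨SimpleFunc.ofIsEmpty, fun _ s => isEmptyElim s⟩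
  -- Points with the same code `k` have kernel values in the same interval of length `δ` for every
  -- `n`; boundedness of `φ` leaves finitely many codes.
  let k : S → Fin N → ℤ := fun s n => ⌊φ (y n, s) / δ⌋
  have hkm : Measurable k := by
    refine measurable_pi_lambda _ fun n => Int.measurable_floor.comp ?_
    have hc : Continuous fun s => φ (y n, s) / δ := by fun_prop
    exact hc.measurable
  have hkf : (Set.range k).Finite := by
    refine (Set.Finite.pi fun _ : Fin N =>
      Set.finite_Icc ⌊-‖φ.toBCF‖ / δ⌋ ⌊‖φ.toBCF‖ / δ⌋).subset ?_
    rintro _ ⟨s, rfl⟩ n -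
    have h := abs_le.1 (φ.toBCF.norm_coe_le_norm (y n, s))
    exact ⟨Int.floor_le_floor (div_le_div_of_nonneg_right h.1 hδ.le),
      Int.floor_le_floor (div_le_div_of_nonneg_right h.2 hδ.le)⟩
  -- `r` picks one representative per attained code, so `r ∘ k` sends each point to a point of its
  -- own cell.
  let r : (Fin N → ℤ) → S := Function.invFun k
  have hr : ∀ s, k (r (k s)) = k s := fun s => Function.invFun_eq ⟨s, rfl⟩
  refine ⟨⟨r ∘ k, fun w => hkm (Set.to_countable (r ⁻¹' {w})).measurableSet, ?_⟩, fun n s => ?_⟩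
  · rw [Set.range_comp]
    exact hkf.image r
  · have h := Int.abs_sub_lt_one_of_floor_eq_floor (congrFun (hr s) n).symm
    rw [← sub_div, abs_div, abs_of_pos hδ, div_lt_one hδ] at h
    exact h.le

variable [T2Space S] {E : Type*} [NormedAddCommGroup E] [NormedSpace ℝ E] [CompleteSpace E]

/-- The sum is the integral of the simple function `φ (y, g ·)`, so the difference integrates a
function bounded by `δ`. -/
theorem norm_integralOp_sub_sum_le (φ : C₀(Y × S, ℝ)) (μ : RadonMeasure S E) (y : Y)
    (g : SimpleFunc S S) {δ : ℝ} (hg : ∀ s, |φ (y, s) - φ (y, g s)| ≤ δ) :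
    ‖integralOp φ μ y - ∑ w ∈ g.range, φ (y, w) • μ (g ⁻¹' {w})‖ ≤ δ * ‖μ‖ := by
  have hind : ∀ w ∈ g.range, (toVectorMeasure μ).Integrable
      ((g ⁻¹' {w}).indicator fun _ => φ (y, w)) := fun w _ =>
    (integrable_const _).indicator (g.measurableSet_fiber w)
  have hsum : (∑ w ∈ g.range, (g ⁻¹' {w}).indicator fun _ => φ (y, w))
      = fun s => φ (y, g s) := by
    funext s
    rw [Finset.sum_apply, Finset.sum_eq_single (g s)]
    · simp
    · intro w _ hw
      exact Set.indicator_of_notMem (by simpa using hw.symm) _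
    · intro h
      exact absurd (g.mem_range_self s) h
  have hint : ∑ w ∈ g.range, φ (y, w) • μ (g ⁻¹' {w})
      = ∫ᵛ s, φ (y, g s) ∂•(toVectorMeasure μ) := by
    rw [← hsum, Finset.sum_fn, VectorMeasure.integral_finsetSum _ hind]
    refine Finset.sum_congr rfl fun w _ => ?_
    rw [VectorMeasure.integral_indicator_const _ (g.measurableSet_fiber w)]
    rfl
  have hgi : (toVectorMeasure μ).Integrable fun s => φ (y, g s) := by
    rw [← hsum]
    exact integrable_finsetSum' _ hind
  rw [hint]
  change ‖∫ᵛ s, φ (y, s) ∂•(toVectorMeasure μ) - _‖ ≤ _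
  rw [← VectorMeasure.integral_fun_sub (integrable_kernel φ y _) hgi]
  refine (VectorMeasure.norm_integral_le_of_norm_le_const (C := δ)
    (Eventually.of_forall hg)).trans ?_
  have h1 : ‖(ContinuousLinearMap.lsmul ℝ ℝ : ℝ →L[ℝ] E →L[ℝ] E)‖ ≤ 1 :=
    ContinuousLinearMap.opNorm_lsmul_le
  -- The sign of `δ` is known only through `hg` at a point; on an empty space both sides vanish.
  rcases isEmpty_or_nonempty S with hS | ⟨⟨s⟩⟩
  · simp [norm_def, Set.eq_empty_of_isEmpty]
  · have hδ : 0 ≤ δ := (abs_nonneg _).trans (hg s)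
    calc _ ≤ δ * 1 * (toVectorMeasure μ).variation.real Set.univ := by gcongr
      _ = δ * ‖μ‖ := by rw [mul_one]; rfl

end Discretization

/-! ### Approximate lifting from `𝓑` to `𝓜(Θ; V)`. -/

section Lifting

variable {Z X Ω Θ : Type*} [TopologicalSpace Z] [TopologicalSpace X]
  [TopologicalSpace Ω] [MeasurableSpace Ω] [BorelSpace Ω] [T2Space Ω]
  [TopologicalSpace Θ] [MeasurableSpace Θ] [BorelSpace Θ] [T2Space Θ]
  {V V' : Type*} [NormedAddCommGroup V] [NormedSpace ℝ V]
  [NormedAddCommGroup V'] [NormedSpace ℝ V']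

/-- The operator `A_{Θ → X}` as a continuous linear map `𝓜(Θ; V) → 𝓑`. -/
def ofMeasureCLM (ψ : C₀(X × Θ, ℝ)) : RadonMeasure Θ V →L[ℝ] IntegralRKBS ψ V :=
  (IntegralRKBS.ofMeasure ψ).mkContinuous 1 fun ν => by
    rw [one_mul]
    exact IntegralRKBS.norm_ofMeasure_le ν

/-- Point evaluation on `𝓑` is bounded by `‖ψ‖`, the reproducing property, and the pairing is
continuous. -/
theorem continuous_measurement (P : ContinuousDualPair V V') (ψ : C₀(X × Θ, ℝ)) {d : ℕ}
    (v' : Fin d → V') (x : Fin d → X) : Continuous (measurement P ψ v' x) := by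
  refine continuous_pi fun j => (P.pairing (v' j)).continuous.comp ?_
  exact (((LinearMap.proj (R := ℝ) (φ := fun _ : X => V) (x j)).comp
    (IntegralRKBS.toFunction (ψ := ψ))).mkContinuous ‖ψ.toBCF‖
      fun f => IntegralRKBS.norm_toFunction_le f (x j)).continuous

/-- Every `𝓑`-valued measure is, up to an arbitrarily small error in the norm and in finitely many
values of its integral transform, the image of an `𝓜(Θ; V)`-valued measure. -/
theorem exists_lift_near [CompleteSpace V] (φ : C₀(Z × Ω, ℝ)) (ψ : C₀(X × Θ, ℝ)) {N : ℕ}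
    (z : Fin N → Z) (μ : RadonMeasure Ω (IntegralRKBS ψ V)) {δ : ℝ} (hδ : 0 < δ) :
    ∃ ρ : RadonMeasure Ω (RadonMeasure Θ V), ‖ρ‖ ≤ ‖μ‖ + δ ∧
      ∀ n, ‖integralOp φ μ (z n) - IntegralRKBS.ofMeasure ψ (integralOp φ ρ (z n))‖
        ≤ δ * ‖μ‖ := by
  obtain ⟨g, hg⟩ := exists_simpleFunc_kernel_near φ z hδ
  -- Each cell may lose this much norm, for a total below `δ`; the `+ 1` keeps the denominator
  -- positive when there are no cells.
  have hpos : 0 < δ / ((g.range.card : ℝ) + 1) := by positivity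
  choose ν hν hlt using fun w => IntegralRKBS.exists_norm_lt (μ (g ⁻¹' {w})) hpos
  refine ⟨∑ w ∈ g.range, RadonMeasure.dirac w (ν w), ?_, fun n => ?_⟩
  · calc ‖∑ w ∈ g.range, RadonMeasure.dirac w (ν w)‖
        ≤ ∑ w ∈ g.range, ‖ν w‖ := norm_sum_le_of_le _ fun w _ => (norm_dirac w _).le
      _ ≤ ∑ w ∈ g.range, (‖μ (g ⁻¹' {w})‖ + δ / ((g.range.card : ℝ) + 1)) :=
        Finset.sum_le_sum fun w _ => (hlt w).le
      _ = ∑ w ∈ g.range, ‖μ (g ⁻¹' {w})‖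
          + (g.range.card : ℝ) / ((g.range.card : ℝ) + 1) * δ := by
        rw [Finset.sum_add_distrib, Finset.sum_const, nsmul_eq_mul]
        ring
      _ ≤ ‖μ‖ + 1 * δ := by
        gcongr
        · exact sum_norm_preimage_le μ g
        · rw [div_le_one (by positivity)]
          linarith
      _ = ‖μ‖ + δ := by rw [one_mul]
  -- The lifts are exact preimages, so the only error in the data is that of the discretization.
  · have h : IntegralRKBS.ofMeasure ψ
        (integralOp φ (∑ w ∈ g.range, RadonMeasure.dirac w (ν w)) (z n))
        = ∑ w ∈ g.range, φ (z n, w) • μ (g ⁻¹' {w}) := by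
      rw [map_sum, Finset.sum_apply, map_sum]
      refine Finset.sum_congr rfl fun w _ => ?_
      rw [integralOp_dirac, map_smul, hν]
    rw [h]
    exact norm_integralOp_sub_sum_le φ μ (z n) g (hg n)

/-- A lower bound of the weight-space objective is a lower bound of the function-space objective. -/
theorem le_functionObjective_of_forall_le_weightObjective [CompleteSpace V]
    (P : ContinuousDualPair V V') (φ : C₀(Z × Ω, ℝ)) (ψ : C₀(X × Θ, ℝ)) {d N : ℕ}
    (v' : Fin d → V') (x : Fin d → X) (z : Fin N → Z) (y : Fin N → Fin d → ℝ)
    (L : (Fin d → ℝ) → (Fin d → ℝ) → ℝ) (hL : ∀ b, Continuous fun a => L a b)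
    {lam : ℝ} (hlam : 0 ≤ lam) {c : ℝ} (hc : ∀ ρ, c ≤ weightObjective P φ ψ v' x z y L lam ρ)
    (μ : RadonMeasure Ω (IntegralRKBS ψ V)) :
    c ≤ functionObjective P φ ψ v' x z y L lam μ := by
  choose ρ hρ hdata using fun m : ℕ =>
    exists_lift_near φ ψ z μ (δ := 1 / ((m : ℝ) + 1)) Nat.one_div_pos_of_nat
  have h0 : Tendsto (fun m : ℕ => 1 / ((m : ℝ) + 1)) atTop (𝓝 0) :=
    tendsto_one_div_add_atTop_nhds_zero_nat
  have hlim : ∀ n, Tendsto (fun m => IntegralRKBS.ofMeasure ψ (integralOp φ (ρ m) (z n))) atTop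
      (𝓝 (integralOp φ μ (z n))) := fun n => by
    rw [tendsto_iff_norm_sub_tendsto_zero]
    refine squeeze_zero (fun _ => norm_nonneg _) (fun m => ?_)
      (by simpa only [zero_mul] using h0.mul_const ‖μ‖)
    rw [norm_sub_rev]
    exact hdata m n
  -- The norms `‖ρ m‖` need not converge, so they are replaced by their upper bounds, which tend to
  -- `‖μ‖`.
  have hobj : Tendsto (fun m : ℕ => (1 / (N : ℝ)) * ∑ n, L (measurement P ψ v' x
      (IntegralRKBS.ofMeasure ψ (integralOp φ (ρ m) (z n)))) (y n)
        + lam * (‖μ‖ + 1 / ((m : ℝ) + 1))) atTop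
      (𝓝 (functionObjective P φ ψ v' x z y L lam μ)) := by
    refine Tendsto.add (Tendsto.const_mul _ (tendsto_finsetSum _ fun n _ => ?_)) ?_
    · exact (((hL (y n)).comp (continuous_measurement P ψ v' x)).tendsto _).comp (hlim n)
    · simpa using (h0.const_add ‖μ‖).const_mul lam
  refine ge_of_tendsto' hobj fun m => (hc (ρ m)).trans ?_
  exact add_le_add le_rfl (mul_le_mul_of_nonneg_left (hρ m) hlam)

end Lifting

end HyperNet
end

/-! ### Comparison of the two problems. -/

theorem mainTheorem12
    {Z X Ω Θ : Type*}
    [TopologicalSpace Z] [LocallyCompactSpace Z] [T2Space Z]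
    [TopologicalSpace X] [LocallyCompactSpace X] [T2Space X]
    [TopologicalSpace Ω] [LocallyCompactSpace Ω] [T2Space Ω] [MeasurableSpace Ω] [BorelSpace Ω]
    [TopologicalSpace Θ] [LocallyCompactSpace Θ] [T2Space Θ] [MeasurableSpace Θ] [BorelSpace Θ]
    {V V' : Type*} [NormedAddCommGroup V] [NormedSpace ℝ V] [CompleteSpace V]
    [NormedAddCommGroup V'] [NormedSpace ℝ V'] [CompleteSpace V']
    (P : HyperNet.ContinuousDualPair V V')
    (φ : C₀(Z × Ω, ℝ)) (ψ : C₀(X × Θ, ℝ))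
    {d N : ℕ} (v' : Fin d → V') (x : Fin d → X) (z : Fin N → Z) (y : Fin N → Fin d → ℝ)
    (L : (Fin d → ℝ) → (Fin d → ℝ) → ℝ) (hL : ∀ b, Continuous fun a => L a b)
    (lam : ℝ) (hlam : 0 ≤ lam)
    (μM : HyperNet.RadonMeasure Ω (HyperNet.RadonMeasure Θ V))
    (hμM : IsMinOn (HyperNet.weightObjective P φ ψ v' x z y L lam) Set.univ μM) :
    ∃ μB : HyperNet.RadonMeasure Ω (HyperNet.IntegralRKBS ψ V),
      (∀ A : Set Ω, MeasurableSet A → μB A = HyperNet.IntegralRKBS.ofMeasure ψ (μM A)) ∧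
      IsMinOn (HyperNet.functionObjective P φ ψ v' x z y L lam) Set.univ μB := by
  have hT : ∀ ν : HyperNet.RadonMeasure Θ V, ‖HyperNet.ofMeasureCLM ψ ν‖ ≤ ‖ν‖ :=
    HyperNet.IntegralRKBS.norm_ofMeasure_le
  refine ⟨HyperNet.RadonMeasure.mapRange (HyperNet.ofMeasureCLM ψ) hT μM,
    fun A _ => HyperNet.RadonMeasure.mapRange_apply _ hT μM A, fun μ _ => ?_⟩
  refine le_trans (b := HyperNet.weightObjective P φ ψ v' x z y L lam μM) ?_
    (HyperNet.le_functionObjective_of_forall_le_weightObjective P φ ψ v' x z y L hL hlam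
      (fun ρ => hμM (Set.mem_univ ρ)) μ)
  unfold HyperNet.functionObjective HyperNet.weightObjective
  -- The data terms now coincide, leaving only the comparison of norms.
  simp only [HyperNet.RadonMeasure.integralOp_mapRange]
  exact add_le_add le_rfl
    (mul_le_mul_of_nonneg_left (HyperNet.RadonMeasure.norm_mapRange_le _ hT μM) hlam)
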